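/- Consider $K$ nodes and $N$ files $w_1,\dots,w_N$ (bit strings of a common length). Node $k$ has to compute $h_k(v_{k,1},\dots,v_{k,N})$, where the intermediate values (IVAs) $v_{q,n}=g_{q,n}(w_n)$, $q\in[K]$, $n\in[N]$, are strings of $T=T_N\ge 1$ bits, the sequence $(T_N)_N$ being given and arbitrary. A map-shuffle-reduce procedure consists of sets $\mathcal M_k\subseteq[N]$ of files stored at the nodes $k\in[K]$; sets $\Lambda_{k,n}\subseteq[K]$ ($n\in\mathcal M_k$), so that node $k$ computes the IVAs with indices in $\mathcal C_k=\{(q,n): n\in\mathcal M_k,\ q\in\Lambda_{k,n}\}$; encoding functions, by which each node $k$ forms from the IVAs in $\mathcal C_k$ a signal $X_k$ of $l_k\ge 0$ bits that is received by all nodes; and decoding functions, by which each node $k$ recovers $v_{k,1},\dots,v_{k,N}$ from $X_1,\dots,X_K$ and the IVAs in $\mathcal C_k$, whatever the files, map functions and reduce functions are. Its storage space, computation load and communication load are $$\frac{\sum_k|\mathcal M_k|}{N},\qquad \frac{\sum_k|\mathcal C_k|}{NK},\qquad \frac{\sum_k l_k}{NKT}.$$ A triple $(r,c,L)$ of real numbers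 is achievable if for every $\epsilon>0$ and all sufficiently large $N$ there is such a procedure whose storage space, computation load and communication load do not exceed $r+\epsilon$, $c+\epsilon$ and $L+\epsilon$, respectively. Let $L^*(r,c)=\inf\{L:(r,c,L)\text{ is achievable}\}$. Let $L^*(r)$, $r\in[1,K]$, be the storage-communication optimum of Li et al., that is, the lower convex envelope of the points $\big(i,\tfrac1i(1-\tfrac iK)\big)$, $i=1,\dots,K$. Finally, for $r\in[1,K)$ let $$c^*(r)=\frac rK+\Big(1-\frac rK\Big)g_r,\qquad g_r=\lfloor r\rfloor+\frac{(r-\lfloor r\rfloor)(K-\lceil r\rceil)}{K-r}.$$ Corollary 1. For all $r\in[1,K)$ and $c\in[c^*(r),r]$, $$L^*(r,c)=L^*(r).$$ So computation load $c^*(r)$ already suffices to attain the minimum shuffle load: $(r,c^*(r),L^*(r))$ is achievable, and $L\ge L^*(r)$ whenever $(r,c,L)$ is achievable for some real $c$. -/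

import Mathlib

namespace MapReduce

/-- Bit strings of length `m` (the underlying set of `𝔽_{2^m}`; a single point if `m = 0`). -/
abbrev Bits (m : ℕ) : Type := Fin m → ZMod 2

/-- A computing job for `K` nodes, `N` files and intermediate values (IVAs) of `T` bits: the
file length `F`, the output length `B`, the map functions `g_{k,n}` and the reduce functions
`h_k`. -/
structure Job (K N T : ℕ) where
  /-- length of a file, in bits -/
  F : ℕ
  F_pos : 0 < F
  /-- length of an output, in bits -/
  B : ℕ
  B_pos : 0 < B
  /-- map functions `g_{k,n}` -/
  mapFn : Fin K → Fin N → Bits F → Bits T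
  /-- reduce functions `h_k` -/
  reduceFn : Fin K → (Fin N → Bits T) → Bits B

namespace Job

variable {K N T : ℕ}

/-- The IVA `v_{k,n} = g_{k,n}(w_n)`. -/
def iva (J : Job K N T) (w : Fin N → Bits J.F) (k : Fin K) (n : Fin N) : Bits T :=
  J.mapFn k n (w n)

/-- The output function `φ_k(w_1, …, w_N) = h_k(g_{k,1}(w_1), …, g_{k,N}(w_N))`. -/
def output (J : Job K N T) (k : Fin K) (w : Fin N → Bits J.F) : Bits J.B :=
  J.reduceFn k (fun n => J.iva w k n)

end Job

/-- The set `𝒞_k` of (indices of) IVAs computed at node `k`: all `(q, n)` such that node `k`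
stores file `n` and `q ∈ Λ_{k,n}`. -/
def computed {K N : ℕ} (M : Fin K → Finset (Fin N)) (Λ : Fin K → Fin N → Finset (Fin K))
    (k : Fin K) : Finset (Fin K × Fin N) :=
  Finset.univ.filter (fun p => p.2 ∈ M k ∧ p.1 ∈ Λ k p.2)

/-- The data of a map-shuffle-reduce procedure for `K` nodes, `N` files and `T`-bit IVAs. -/
structure Procedure (K N T : ℕ) where
  /-- files stored at each node -/
  M : Fin K → Finset (Fin N)
  /-- `Λ k n`: the indices `q` of the IVAs `v_{q,n}` that node `k` computes from file `n`
  (relevant only for `n ∈ M k`) -/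
  Λ : Fin K → Fin N → Finset (Fin K)
  /-- lengths, in bits, of the multicast signals -/
  l : Fin K → ℕ
  /-- encoding functions: the signal of node `k` depends on the IVAs computed there only -/
  encode : (k : Fin K) → (computed M Λ k → Bits T) → Bits (l k)
  /-- decoding functions -/
  decode : (k : Fin K) → ((i : Fin K) → Bits (l i)) → (computed M Λ k → Bits T) →
    (Fin N → Bits T)

namespace Procedure

variable {K N T : ℕ}

/-- The IVAs available at node `k` after the map phase. -/
def localIVAs (P : Procedure K N T) (J : Job K N T) (w : Fin N → Bits J.F) (k : Fin K) :
    computed P.M P.Λ k → Bits T :=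
  fun p => J.iva w p.1.1 p.1.2

/-- The signal `X_k` multicast by node `k` in the shuffle phase. -/
def signal (P : Procedure K N T) (J : Job K N T) (w : Fin N → Bits J.F) (k : Fin K) :
    Bits (P.l k) :=
  P.encode k (P.localIVAs J w k)

/-- The `N` values that node `k` decodes in the reduce phase. -/
def decoded (P : Procedure K N T) (J : Job K N T) (w : Fin N → Bits J.F) (k : Fin K) :
    Fin N → Bits T :=
  P.decode k (fun i => P.signal J w i) (P.localIVAs J w k)

/-- The procedure is correct: for every job and all files, every node `k` recovers
`v_{k,1}, …, v_{k,N}`. -/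
def Correct (P : Procedure K N T) : Prop :=
  ∀ (J : Job K N T) (w : Fin N → Bits J.F) (k : Fin K), P.decoded J w k = J.iva w k

/-- Under a correct procedure, node `k` obtains its output `u_k = φ_k(w_1, …, w_N)`. -/
theorem Correct.reduce_eq_output {P : Procedure K N T} (hP : P.Correct) (J : Job K N T)
    (w : Fin N → Bits J.F) (k : Fin K) :
    J.reduceFn k (P.decoded J w k) = J.output k w := by
  rw [hP J w k]; rfl

/-- Storage space: number of files stored across the nodes, divided by `N`. -/
noncomputable def storageSpace (P : Procedure K N T) : ℝ :=
  (∑ k, ((P.M k).card : ℝ)) / N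

/-- Computation load: number of IVAs computed across the nodes, divided by `N K`. -/
noncomputable def computationLoad (P : Procedure K N T) : ℝ :=
  (∑ k, ((computed P.M P.Λ k).card : ℝ)) / (N * K)

/-- Communication load: number of transmitted bits, divided by `N K T`. -/
noncomputable def communicationLoad (P : Procedure K N T) : ℝ :=
  (∑ k, (P.l k : ℝ)) / (N * K * T)

end Procedure

/-- Achievability of the storage-computation-communication triple `(r, c, L)` with `K` nodes.
`T N` is the length of the IVAs when there are `N` files. -/
def Achievable (K : ℕ) (T : ℕ → ℕ) (r c L : ℝ) : Prop :=
  ∀ ε : ℝ, 0 < ε → ∃ N₀ : ℕ, 0 < N₀ ∧ ∀ N : ℕ, N₀ ≤ N →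
    ∃ P : Procedure K N (T N), P.Correct ∧
      P.storageSpace ≤ r + ε ∧ P.computationLoad ≤ c + ε ∧ P.communicationLoad ≤ L + ε

/-- The optimal communication load `L^*(r, c)`. -/
noncomputable def optimalLoad (K : ℕ) (T : ℕ → ℕ) (r c : ℝ) : ℝ :=
  sInf {L : ℝ | Achievable K T r c L}

/-- The lower convex envelope, at `x`, of a set of points in the plane. -/
noncomputable def lowerConvexEnvelope (S : Set (ℝ × ℝ)) (x : ℝ) : ℝ :=
  sInf {y : ℝ | (x, y) ∈ convexHull ℝ S}

/-- The storage-communication optimum `L^*(r)`: the lower convex envelope of the points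
`(i, (1 / i) (1 - i / K))`, `i = 1, …, K`. -/
noncomputable def storageOptimum (K : ℕ) (r : ℝ) : ℝ :=
  lowerConvexEnvelope
    {p : ℝ × ℝ | ∃ i : ℕ, 1 ≤ i ∧ i ≤ K ∧ p = ((i : ℝ), 1 / (i : ℝ) * (1 - (i : ℝ) / K))} r

/-- `g_r`. -/
noncomputable def gThreshold (K : ℕ) (r : ℝ) : ℝ :=
  (⌊r⌋ : ℝ) + (r - (⌊r⌋ : ℝ)) * ((K : ℝ) - (⌈r⌉ : ℝ)) / ((K : ℝ) - r)

/-- `c^*(r)`. -/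
noncomputable def cStar (K : ℕ) (r : ℝ) : ℝ :=
  r / K + (1 - r / K) * gThreshold K r

end MapReduce

/-! Converse. Take all IVAs independent and uniform; entropy of functions of them is fiber counting
on a finite set. For a set `R` of nodes, condition the signals on the outputs and files of `R`.
Adding a node `k` outside `R` to the conditioning reveals its files, and the signals must then
account for its IVAs of files unseen by `insert k R`. Submodularity turns this into a recursion
averaged over `k` (`sum_residualEntropy_le`). Its solution from `R = univ` back to `R = ∅` says that
a file held by `h` nodes costs `T (K - h) / h` bits, hence contributes `1 / h - 1 / K` to the
normalized load (`le_communicationLoad`). This quantity lies above the chord between the consecutive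
integers around `r`, at every positive integer `h`. The chord is affine and the mean of `h` is the
storage space, so averaging over files gives `chord` at the storage space; on that interval `chord`
is the convex envelope.

Achievability. Store each file at a set of `i` or `i + 1` nodes, `i = ⌊r⌋`, spread evenly over all
such sets. For every set `S`, each member sends sums of IVA bits, each term wanted by one node of
`S` and computed by all the others. A node storing a file needs only its own IVA and those of the
nodes lacking the file. A file at `j` nodes therefore costs `j (K - j + 1)` IVA computations, and
the mixture of `i` and `i + 1` yields exactly `cStar`. Rounding errors are bounded independently of
`N`, up to a factor of order `T` in the bit count. -/

namespace MapReduce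

/-! ### Entropy of functions on a finite uniform probability space. -/

section Entropy

open Finset

variable {Ω α β γ δ : Type*} [Fintype Ω]

open Classical in
/-- The number of points of `Ω` at which `f` has the same value as at `ω`. -/
noncomputable def fiberCard (f : Ω → α) (ω : Ω) : ℝ :=
  ∑ x, if f x = f ω then 1 else 0

/-- Shannon entropy (in nats) of `f` under the uniform distribution on `Ω`. -/
noncomputable def entropy (f : Ω → α) : ℝ :=
  Real.log (Fintype.card Ω) - (∑ ω, Real.log (fiberCard f ω)) / Fintype.card Ω

theorem fiberCard_pos (f : Ω → α) (ω : Ω) : 0 < fiberCard f ω := by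
  classical
  unfold fiberCard
  refine Finset.sum_pos' (fun x _ => by split_ifs <;> norm_num) ⟨ω, mem_univ _, by simp⟩

theorem fiberCard_congr (f : Ω → α) {x y : Ω} (h : f x = f y) : fiberCard f x = fiberCard f y := by
  unfold fiberCard
  rw [h]

open Classical in
theorem fiberCard_eq_card (f : Ω → α) (ω : Ω) :
    fiberCard f ω = ({x | f x = f ω} : Finset Ω).card := by
  unfold fiberCard
  rw [← Finset.sum_filter, Finset.sum_const, nsmul_eq_mul, mul_one]

theorem fiberCard_mono {f : Ω → α} {g : Ω → β} (h : ∀ x y, f x = f y → g x = g y) (ω : Ω) :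
    fiberCard f ω ≤ fiberCard g ω := by
  classical
  unfold fiberCard
  refine Finset.sum_le_sum fun x _ => ?_
  split_ifs with h1 h2 h2
  · exact le_rfl
  · exact absurd (h _ _ h1) h2
  · norm_num
  · exact le_rfl

theorem entropy_mono {f : Ω → α} {g : Ω → β} (h : ∀ x y, f x = f y → g x = g y) :
    entropy g ≤ entropy f := by
  unfold entropy
  have : ∑ ω, Real.log (fiberCard f ω) ≤ ∑ ω, Real.log (fiberCard g ω) :=
    Finset.sum_le_sum fun ω _ => Real.log_le_log (fiberCard_pos f ω) (fiberCard_mono h ω)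
  gcongr

theorem entropy_congr {f : Ω → α} {g : Ω → β} (h : ∀ x y, f x = f y ↔ g x = g y) :
    entropy f = entropy g :=
  le_antisymm (entropy_mono fun x y => (h x y).2) (entropy_mono fun x y => (h x y).1)

theorem entropy_eq_of_fiberCard_eq [Nonempty Ω] {f : Ω → α} {c : ℝ}
    (h : ∀ ω, fiberCard f ω = c) :
    entropy f = Real.log (Fintype.card Ω) - Real.log c := by
  have : (Fintype.card Ω : ℝ) ≠ 0 := by exact_mod_cast Fintype.card_ne_zero
  simp only [entropy, h, Finset.sum_const, Finset.card_univ, nsmul_eq_mul]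
  field_simp

theorem entropy_of_subsingleton [Nonempty Ω] {f : Ω → α} (h : ∀ x y, f x = f y) :
    entropy f = 0 := by
  classical
  rw [entropy_eq_of_fiberCard_eq (c := Fintype.card Ω), sub_self]
  intro ω
  simp [fiberCard, h _ ω]

/-- The set `s` lies in a single fiber of `u`, and every summand is the inverse of the size of that
fiber. -/
theorem sum_inv_fiberCard_le_one (u : Ω → α) (s : Finset Ω)
    (hs : ∀ x ∈ s, ∀ y ∈ s, u x = u y) : ∑ ω ∈ s, (fiberCard u ω)⁻¹ ≤ 1 := by
  classical
  rcases s.eq_empty_or_nonempty with rfl | ⟨x, hx⟩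
  · simp
  have hcard : (s.card : ℝ) ≤ fiberCard u x := by
    rw [fiberCard_eq_card]
    exact_mod_cast Finset.card_le_card fun y hy => by simp [hs y hy x hx]
  calc ∑ ω ∈ s, (fiberCard u ω)⁻¹ = ∑ ω ∈ s, (fiberCard u x)⁻¹ :=
        Finset.sum_congr rfl fun y hy => by rw [fiberCard_congr u (hs y hy x hx)]
    _ = s.card * (fiberCard u x)⁻¹ := by simp
    _ ≤ fiberCard u x * (fiberCard u x)⁻¹ := by
        have := (fiberCard_pos u x).le
        gcongr
    _ = 1 := mul_inv_cancel₀ (fiberCard_pos u x).ne'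

/-- The numerator counts pairs `(x, y)` with `p x = p ω` and `q y = q ω`. For a fixed pair, the
admissible `ω` lie in one fiber of `u`, and there are none unless `h x = h y`. The pair thus
contributes at most the inverse size of the `h`-fiber of `x`, and summing over `y` leaves at most
`1` for each `x`. -/
theorem sum_fiberCard_quotient_le {p : Ω → α} {q : Ω → β} {u : Ω → γ} {h : Ω → δ}
    (hp : ∀ x y, p x = p y → h x = h y) (hq : ∀ x y, q x = q y → h x = h y)
    (hu : ∀ x y, p x = p y → q x = q y → u x = u y) :
    ∑ ω, fiberCard p ω * fiberCard q ω / (fiberCard u ω * fiberCard h ω) ≤ Fintype.card Ω := by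
  classical
  have key : ∀ ω, fiberCard p ω * fiberCard q ω / (fiberCard u ω * fiberCard h ω) =
      ∑ x, ∑ y, if p x = p ω ∧ q y = q ω then (fiberCard u ω)⁻¹ * (fiberCard h x)⁻¹ else 0 := by
    intro ω
    rw [div_eq_mul_inv, mul_inv]
    conv_lhs => rw [fiberCard, fiberCard, Finset.sum_mul_sum, Finset.sum_mul]
    refine Finset.sum_congr rfl fun x _ => ?_
    rw [Finset.sum_mul]
    refine Finset.sum_congr rfl fun y _ => ?_
    by_cases h1 : p x = p ω
    · rw [fiberCard_congr h (hp _ _ h1)]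
      by_cases h2 : q y = q ω <;> simp [h1, h2]
    · simp [h1]
  simp_rw [key]
  rw [Finset.sum_comm]
  calc ∑ x, ∑ ω, ∑ y, (if p x = p ω ∧ q y = q ω then
          (fiberCard u ω)⁻¹ * (fiberCard h x)⁻¹ else 0)
      = ∑ x, ∑ y, (∑ ω with p x = p ω ∧ q y = q ω, (fiberCard u ω)⁻¹) * (fiberCard h x)⁻¹ := by
        refine Finset.sum_congr rfl fun x _ => ?_
        rw [Finset.sum_comm]
        refine Finset.sum_congr rfl fun y _ => ?_
        rw [Finset.sum_mul, Finset.sum_filter]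
    _ ≤ ∑ x, ∑ y, (if h y = h x then 1 else 0) * (fiberCard h x)⁻¹ := by
        refine Finset.sum_le_sum fun x _ => Finset.sum_le_sum fun y _ => ?_
        refine mul_le_mul_of_nonneg_right ?_ (inv_nonneg.2 (fiberCard_pos h x).le)
        split_ifs with hxy
        · refine sum_inv_fiberCard_le_one u _ fun a ha b hb => ?_
          simp only [mem_filter, mem_univ, true_and] at ha hb
          exact hu _ _ (ha.1.symm.trans hb.1) (ha.2.symm.trans hb.2)
        · rw [Finset.sum_eq_zero]
          intro ω hω
          simp only [mem_filter, mem_univ, true_and] at hω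
          exact absurd ((hq _ _ hω.2).trans (hp _ _ hω.1).symm) hxy
    _ = ∑ x : Ω, (1 : ℝ) := by
        refine Finset.sum_congr rfl fun x _ => ?_
        rw [← Finset.sum_mul]
        exact mul_inv_cancel₀ (fiberCard_pos h x).ne'
    _ = Fintype.card Ω := by simp

/-- Submodularity of entropy: `p` and `q` determine `u`, and each of them determines `h`. -/
theorem entropy_submodular {p : Ω → α} {q : Ω → β} {u : Ω → γ} {h : Ω → δ}
    (hp : ∀ x y, p x = p y → h x = h y) (hq : ∀ x y, q x = q y → h x = h y)
    (hu : ∀ x y, p x = p y → q x = q y → u x = u y) :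
    entropy u + entropy h ≤ entropy p + entropy q := by
  have hsum : ∑ ω, (Real.log (fiberCard p ω) + Real.log (fiberCard q ω) -
      (Real.log (fiberCard u ω) + Real.log (fiberCard h ω))) ≤ 0 := by
    -- The inequality `log x ≤ x - 1` reduces the claim to the quotient bound.
    calc _ ≤ ∑ ω, (fiberCard p ω * fiberCard q ω / (fiberCard u ω * fiberCard h ω) - 1) := by
          refine Finset.sum_le_sum fun ω _ => ?_
          have h1 := fiberCard_pos p ω
          have h2 := fiberCard_pos q ω
          have h3 := fiberCard_pos u ω
          have h4 := fiberCard_pos h ω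
          rw [← Real.log_mul h1.ne' h2.ne', ← Real.log_mul h3.ne' h4.ne',
            ← Real.log_div (by positivity) (by positivity)]
          exact Real.log_le_sub_one_of_pos (by positivity)
      _ ≤ 0 := by
          rw [Finset.sum_sub_distrib]
          simpa using sum_fiberCard_quotient_le hp hq hu
  simp only [Finset.sum_sub_distrib, Finset.sum_add_distrib] at hsum
  have := div_nonpos_of_nonpos_of_nonneg hsum (Nat.cast_nonneg (α := ℝ) (Fintype.card Ω))
  rw [sub_div, add_div, add_div] at this
  unfold entropy
  linarith

theorem entropy_le_log_card [Nonempty Ω] [Fintype α] (f : Ω → α) :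
    entropy f ≤ Real.log (Fintype.card α) := by
  classical
  have hΩ : (0 : ℝ) < Fintype.card Ω := by exact_mod_cast Fintype.card_pos
  have hα : (0 : ℝ) < Fintype.card α := by
    have : Nonempty α := ⟨f (Classical.arbitrary Ω)⟩
    exact_mod_cast Fintype.card_pos
  -- Each value taken by `f` contributes exactly `1` to this sum.
  have hinv : ∑ ω, (fiberCard f ω)⁻¹ ≤ Fintype.card α := by
    rw [← Finset.sum_fiberwise (s := univ) (g := f)]
    calc _ ≤ ∑ a : α, (1 : ℝ) := Finset.sum_le_sum fun a _ =>
          sum_inv_fiberCard_le_one f _ fun x hx y hy => by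
            simp only [mem_filter, mem_univ, true_and] at hx hy
            rw [hx, hy]
      _ = _ := by simp
  have hsum : ∑ ω, (Real.log (Fintype.card Ω) - Real.log (fiberCard f ω) -
      Real.log (Fintype.card α)) ≤ 0 := by
    calc _ ≤ ∑ ω, (Fintype.card Ω / Fintype.card α * (fiberCard f ω)⁻¹ - 1 : ℝ) := by
          refine Finset.sum_le_sum fun ω _ => ?_
          have h1 := fiberCard_pos f ω
          rw [← Real.log_div hΩ.ne' h1.ne', ← Real.log_div (by positivity) hα.ne']
          refine (Real.log_le_sub_one_of_pos (by positivity)).trans (le_of_eq ?_)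
          field_simp
      _ ≤ 0 := by
          rw [Finset.sum_sub_distrib, ← Finset.mul_sum]
          have : (Fintype.card Ω / Fintype.card α : ℝ) * ∑ ω, (fiberCard f ω)⁻¹ ≤
              Fintype.card Ω / Fintype.card α * Fintype.card α := by gcongr
          rw [div_mul_cancel₀ _ hα.ne'] at this
          simpa using this
  simp only [Finset.sum_sub_distrib, Finset.sum_const, card_univ, nsmul_eq_mul] at hsum
  unfold entropy
  have h2 : (∑ ω, Real.log (fiberCard f ω)) / Fintype.card Ω ≥
      Real.log (Fintype.card Ω) - Real.log (Fintype.card α) := by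
    rw [ge_iff_le, le_div_iff₀ hΩ]
    linarith
  linarith

theorem entropy_restrict {ι A : Type*} [Fintype ι] [DecidableEq ι] [Fintype A] [Nonempty A]
    (D : Finset ι) :
    entropy (fun (ω : ι → A) (i : D) => ω i) = D.card * Real.log (Fintype.card A) := by
  classical
  have hA : (Fintype.card A : ℝ) ≠ 0 := by exact_mod_cast Fintype.card_ne_zero
  rw [entropy_eq_of_fiberCard_eq (c := (Fintype.card A : ℝ) ^ (Dᶜ).card)]
  · rw [Fintype.card_fun, Nat.cast_pow, Real.log_pow, Real.log_pow, ← sub_mul,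
      ← Finset.card_add_card_compl D]
    push_cast
    ring
  · intro ω
    have : fiberCard (fun (ω : ι → A) (i : D) => ω i) ω =
        (Fintype.piFinset fun i => if i ∈ D then {ω i} else (univ : Finset A)).card := by
      rw [fiberCard_eq_card]
      congr 2
      ext x
      simp only [funext_iff, mem_filter, mem_univ, true_and, Fintype.mem_piFinset, Subtype.forall]
      refine forall_congr' fun i => ?_
      by_cases hi : i ∈ D <;> simp [hi]
    rw [this, Fintype.card_piFinset, ← Nat.cast_pow]
    congr 1
    rw [← Finset.prod_mul_prod_compl D, Finset.prod_eq_one, one_mul, Finset.prod_eq_pow_card]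
    · intro i hi
      rw [if_neg (by simpa using hi), card_univ]
    · intro i hi
      rw [if_pos hi, card_singleton]

end Entropy

/-! ### Entropy lower bound for the total signal length. -/

section Converse

open Finset

variable {K N : ℕ} {A : Type}

/-- The IVAs that are known once the outputs of the nodes in `R` and the files stored at these
nodes are known. -/
def known (M : Fin K → Finset (Fin N)) (R : Finset (Fin K)) : Finset (Fin K × Fin N) :=
  {p | p.1 ∈ R ∨ ∃ k ∈ R, p.2 ∈ M k}

/-- The nodes that store file `n`. -/
def holders (M : Fin K → Finset (Fin N)) (n : Fin N) : Finset (Fin K) := {k | n ∈ M k}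

/-- The files that are stored at none of the nodes in `R`. -/
def unseen (M : Fin K → Finset (Fin N)) (R : Finset (Fin K)) : Finset (Fin N) :=
  {n | ∀ k ∈ R, n ∉ M k}

theorem restrict_eq_iff {D : Finset (Fin K × Fin N)} {v v' : Fin K × Fin N → A} :
    ((fun p : D => v p) = fun p : D => v' p) ↔ ∀ p ∈ D, v p = v' p := by
  simp [funext_iff]

/-- The second summand counts the IVAs that node `k` must learn from the signals even when helped by
everything known from `R`. -/
theorem card_known_insert (M : Fin K → Finset (Fin N)) {R : Finset (Fin K)} {k : Fin K}
    (hk : k ∉ R) :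
    (known M (insert k R)).card =
      (known M R ∪ univ ×ˢ M k).card + (unseen M (insert k R)).card := by
  have h : known M (insert k R) =
      (known M R ∪ univ ×ˢ M k) ∪ (unseen M (insert k R)).image (Prod.mk k) := by
    ext ⟨q, n⟩
    simp only [known, unseen, mem_filter, mem_univ, true_and, mem_union, mem_product, mem_image,
      mem_insert, Prod.mk.injEq, exists_eq_right_right, forall_eq_or_imp, exists_eq_or_imp]
    by_cases h1 : n ∈ M k
    · simp [h1]
    · by_cases h2 : ∃ a ∈ R, n ∈ M a
      · simp [h2]
      · have h3 : ∀ a ∈ R, n ∉ M a := by simpa using h2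
        simp only [h1, h2, eq_comm (a := k)]
        grind
  rw [h, card_union_of_disjoint, card_image_of_injective _ (Prod.mk_right_injective k)]
  rw [disjoint_left]
  rintro ⟨q, n⟩ h1 h2
  simp only [known, unseen, mem_filter, mem_univ, true_and, mem_union, mem_product, mem_image,
      mem_insert, Prod.mk.injEq, exists_eq_right_right, forall_eq_or_imp] at h1 h2
  grind

/-- The signals are determined by the files of the senders, and together with its own files they
determine the output of each node. -/
structure IsScheme (M : Fin K → Finset (Fin N)) {β : Fin K → Type}
    (X : ∀ i, (Fin K × Fin N → A) → β i) : Prop where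
  encode : ∀ i v v', (∀ q, ∀ n ∈ M i, v (q, n) = v' (q, n)) → X i v = X i v'
  decode : ∀ k v v', (∀ q, ∀ n ∈ M k, v (q, n) = v' (q, n)) → (∀ i, X i v = X i v') →
    ∀ n, v (k, n) = v' (k, n)

variable {M : Fin K → Finset (Fin N)} {β : Fin K → Type} {X : ∀ i, (Fin K × Fin N → A) → β i}

/-- A file stored nowhere influences no signal and no local data, so changing its IVAs could not be
noticed. -/
theorem IsScheme.holders_nonempty [Nontrivial A] (hX : IsScheme M X) (hK : 0 < K) (n : Fin N) :
    (holders M n).Nonempty := by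
  classical
  by_contra h
  have hM : ∀ k, n ∉ M k := by
    intro k hk
    exact h ⟨k, by simp [holders, hk]⟩
  obtain ⟨a, b, hab⟩ := exists_pair_ne A
  let v : Fin K × Fin N → A := fun _ => a
  let v' : Fin K × Fin N → A := fun p => if p.2 = n then b else a
  have hv : ∀ k q, ∀ m ∈ M k, v (q, m) = v' (q, m) := by
    intro k q m hm
    have : m ≠ n := fun h => hM k (h ▸ hm)
    simp [v, v', this]
  refine hab ?_
  simpa [v, v'] using hX.decode ⟨0, hK⟩ v v' (hv _) (fun i => hX.encode i v v' (hv i)) n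

variable [Fintype A]

/-- Conditional entropy of the signals given the IVAs known from the nodes in `R`. -/
noncomputable def residualEntropy (M : Fin K → Finset (Fin N)) {β : Fin K → Type}
    (X : ∀ i, (Fin K × Fin N → A) → β i) (R : Finset (Fin K)) : ℝ :=
  entropy (fun v => ((fun p : known M R => v p), fun i => X i v)) -
    entropy (fun (v : Fin K × Fin N → A) (p : known M R) => v p)

theorem residualEntropy_nonneg (M : Fin K → Finset (Fin N)) {β : Fin K → Type}
    (X : ∀ i, (Fin K × Fin N → A) → β i) (R : Finset (Fin K)) :
    0 ≤ residualEntropy M X R :=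
  sub_nonneg.2 (entropy_mono fun _ _ h => (Prod.ext_iff.1 h).1)

/-- Subadditivity of conditional entropy, by adding one signal at a time. -/
theorem entropy_signals_le_sum (M : Fin K → Finset (Fin N)) {β : Fin K → Type}
    (X : ∀ i, (Fin K × Fin N → A) → β i) (R S : Finset (Fin K)) :
    entropy (fun v => ((fun p : known M R => v p), fun i : S => X i v)) -
        entropy (fun (v : Fin K × Fin N → A) (p : known M R) => v p) ≤
      ∑ k ∈ S, (entropy (fun v => ((fun p : known M R => v p), X k v)) -
        entropy (fun (v : Fin K × Fin N → A) (p : known M R) => v p)) := by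
  induction S using Finset.induction_on with
  | empty =>
    rw [Finset.sum_empty, sub_nonpos]
    refine entropy_mono fun x y h => Prod.ext h ?_
    funext i
    exact absurd i.2 (Finset.notMem_empty _)
  | insert k S hk ih =>
    rw [Finset.sum_insert hk]
    have := entropy_submodular
      (p := fun v : Fin K × Fin N → A => ((fun p : known M R => v p), X k v))
      (q := fun v => ((fun p : known M R => v p), fun i : S => X i v))
      (u := fun v => ((fun p : known M R => v p), fun i : (insert k S : Finset _) => X i v))
      (h := fun (v : Fin K × Fin N → A) (p : known M R) => v p)
      (fun x y h => (Prod.ext_iff.1 h).1) (fun x y h => (Prod.ext_iff.1 h).1)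
      (fun x y h1 h2 => by
        refine Prod.ext (Prod.ext_iff.1 h1).1 ?_
        funext ⟨i, hi⟩
        rcases Finset.mem_insert.1 hi with rfl | hi
        · exact (Prod.ext_iff.1 h1).2
        · exact congrFun (Prod.ext_iff.1 h2).2 ⟨i, hi⟩)
    linarith

variable [Nonempty A]

/-- Replacing the condition `X k` by all files of node `k` can only lower the conditional entropy of
the signals. Given those files, the signals reveal the output row of `k`, whose unseen part is fresh
and uniform. -/
theorem IsScheme.residualEntropy_insert_le (hX : IsScheme M X) {R : Finset (Fin K)} {k : Fin K}
    (hk : k ∉ R) :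
    residualEntropy M X (insert k R) +
        (unseen M (insert k R)).card * Real.log (Fintype.card A) ≤
      entropy (fun v => ((fun p : known M R => v p), fun i => X i v)) -
        entropy (fun v => ((fun p : known M R => v p), X k v)) := by
  have hsub : ∀ x y : Fin K × Fin N → A, (∀ p ∈ known M R ∪ univ ×ˢ M k, x p = y p) →
      (∀ p ∈ known M R, x p = y p) ∧ ∀ q, ∀ n ∈ M k, x (q, n) = y (q, n) := fun x y h =>
    ⟨fun p hp => h p (mem_union_left _ hp), fun q n hn => h _ (mem_union_right _ (by simp [hn]))⟩
  have h1 := entropy_submodular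
      (p := fun v : Fin K × Fin N → A => ((fun p : known M R => v p), fun i => X i v))
      (q := fun v => (fun p : (known M R ∪ univ ×ˢ M k : Finset _) => v p))
      (u := fun v => ((fun p : known M (insert k R) => v p), fun i => X i v))
      (h := fun v => ((fun p : known M R => v p), X k v))
      (fun x y h => by
        simp only [Prod.mk.injEq] at h ⊢
        exact ⟨h.1, congrFun h.2 k⟩)
      (fun x y h => by
        simp only [Prod.mk.injEq, restrict_eq_iff] at h ⊢
        exact ⟨(hsub x y h).1, hX.encode _ _ _ (hsub x y h).2⟩)
      (fun x y h h' => by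
        simp only [Prod.mk.injEq, restrict_eq_iff] at h h' ⊢
        refine ⟨?_, h.2⟩
        have h2 := hX.decode k x y (hsub x y h').2 (congrFun h.2)
        rintro ⟨q, n⟩ hp
        simp only [known, mem_filter, mem_univ, true_and, mem_insert, exists_eq_or_imp] at hp
        rcases hp with (rfl | hq) | hn | hn
        · exact h2 n
        · exact h.1 _ (by simp [known, hq])
        · exact (hsub x y h').2 _ _ hn
        · exact h.1 _ (by simp [known, hn]))
  have h3 : entropy (fun (v : Fin K × Fin N → A) (p : known M (insert k R)) => v p) =
      entropy (fun (v : Fin K × Fin N → A) (p : (known M R ∪ univ ×ˢ M k : Finset _)) => v p) +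
        (unseen M (insert k R)).card * Real.log (Fintype.card A) := by
    rw [entropy_restrict, entropy_restrict, card_known_insert M hk]
    push_cast
    ring
  unfold residualEntropy
  linarith

/-- Senders in `R` add nothing once their files are known, so the signals from `Rᶜ` carry the whole
residual entropy; subadditivity over `Rᶜ` accounts for the `-1`. -/
theorem IsScheme.sum_residualEntropy_le (hX : IsScheme M X) (R : Finset (Fin K)) :
    ∑ k ∈ Rᶜ, (residualEntropy M X (insert k R) +
        (unseen M (insert k R)).card * Real.log (Fintype.card A)) ≤
      ((Rᶜ.card : ℝ) - 1) * residualEntropy M X R := by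
  have h1 := entropy_signals_le_sum M X R Rᶜ
  have h2 : entropy (fun v => ((fun p : known M R => v p), fun i : (Rᶜ : Finset _) => X i v)) =
      entropy (fun v : Fin K × Fin N → A => ((fun p : known M R => v p), fun i => X i v)) := by
    refine entropy_congr fun x y => ?_
    simp only [Prod.mk.injEq, restrict_eq_iff, and_congr_right_iff]
    intro h
    refine ⟨fun h' => ?_, fun h' => funext fun i => congrFun h' _⟩
    funext i
    by_cases hi : i ∈ R
    · exact hX.encode i x y fun q n hn => h _ (by
        simp only [known, mem_filter, mem_univ, true_and]
        exact Or.inr ⟨i, hi, hn⟩)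
    · exact congrFun h' ⟨i, by simpa using hi⟩
  have h3 := Finset.sum_le_sum fun k (hk : k ∈ Rᶜ) =>
    hX.residualEntropy_insert_le (by simpa using hk : k ∉ R)
  refine h3.trans ?_
  rw [h2] at h1
  simp only [Finset.sum_sub_distrib, Finset.sum_const, nsmul_eq_mul] at h1 ⊢
  unfold residualEntropy
  linarith

/-- A file unseen by `R` remains unseen after adding `k` exactly when `k` is not one of its holders,
all of which lie outside `R`. -/
theorem sum_compl_sum_unseen (M : Fin K → Finset (Fin N)) (R : Finset (Fin K)) (f : Fin N → ℝ) :
    ∑ k ∈ Rᶜ, ∑ n ∈ unseen M (insert k R), f n =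
      ∑ n ∈ unseen M R, ((Rᶜ.card : ℝ) - (holders M n).card) * f n := by
  rw [Finset.sum_comm' (t' := unseen M R) (s' := fun n => Rᶜ \ holders M n)]
  · refine Finset.sum_congr rfl fun n hn => ?_
    have hsub : holders M n ⊆ Rᶜ := by
      intro k hk
      simp only [unseen, holders, mem_filter, mem_univ, true_and, mem_compl] at hn hk ⊢
      exact fun h => hn k h hk
    rw [Finset.sum_const, nsmul_eq_mul, Finset.card_sdiff_of_subset hsub,
      Nat.cast_sub (card_le_card hsub)]
  · intro k n
    simp only [unseen, holders, mem_filter, mem_univ, true_and, mem_compl, mem_insert,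
      forall_eq_or_imp, mem_sdiff]
    tauto

theorem IsScheme.le_residualEntropy (hX : IsScheme M X) (s : ℕ) :
    ∀ R : Finset (Fin K), Rᶜ.card = s →
      Real.log (Fintype.card A) * ∑ n ∈ unseen M R,
        ((s : ℝ) - (holders M n).card) / (holders M n).card ≤ residualEntropy M X R := by
  have hlog : 0 ≤ Real.log (Fintype.card A) :=
    Real.log_nonneg (by exact_mod_cast Fintype.card_pos (α := A))
  induction s with
  | zero =>
    intro R hR
    refine le_trans ?_ (residualEntropy_nonneg M X R)
    refine mul_nonpos_of_nonneg_of_nonpos hlog (Finset.sum_nonpos fun n _ => ?_)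
    refine div_nonpos_of_nonpos_of_nonneg ?_ (by positivity)
    simp
  | succ s ih =>
    intro R hR
    -- The recursion bounds `s` times the residual entropy, so it is void for `s = 0`; there the
    -- left side is nonpositive, the term with no holders being `0` by division by zero.
    rcases Nat.eq_zero_or_pos s with rfl | hs
    · refine le_trans ?_ (residualEntropy_nonneg M X R)
      refine mul_nonpos_of_nonneg_of_nonpos hlog (Finset.sum_nonpos fun n _ => ?_)
      rcases Nat.eq_zero_or_pos (holders M n).card with h | h
      · simp [h]
      · refine div_nonpos_of_nonpos_of_nonneg ?_ (by positivity)
        have : (1 : ℝ) ≤ (holders M n).card := by exact_mod_cast h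
        simpa using this
    have hs' : (0 : ℝ) < s := by exact_mod_cast hs
    have h1 := hX.sum_residualEntropy_le R
    have h2 : ∑ k ∈ Rᶜ, (Real.log (Fintype.card A) * ∑ n ∈ unseen M (insert k R),
        (((s : ℝ) - (holders M n).card) / (holders M n).card + 1)) ≤
        ∑ k ∈ Rᶜ, (residualEntropy M X (insert k R) +
          (unseen M (insert k R)).card * Real.log (Fintype.card A)) := by
      refine Finset.sum_le_sum fun k hk => ?_
      have hcard : (insert k R)ᶜ.card = s := by
        rw [compl_insert, card_erase_of_mem hk, hR, Nat.add_sub_cancel]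
      have := ih (insert k R) hcard
      rw [Finset.sum_add_distrib, Finset.sum_const, nsmul_eq_mul]
      linarith
    rw [← Finset.mul_sum, sum_compl_sum_unseen, hR] at h2
    rw [hR] at h1
    -- With `h` holders, `(s - h) / h + 1 = s / h`, so the terms agree when `h > 0`; for `h = 0` the
    -- left term is `0` by convention.
    have h3 : (s : ℝ) * ∑ n ∈ unseen M R,
        (((s + 1 : ℕ) : ℝ) - (holders M n).card) / (holders M n).card ≤
        ∑ n ∈ unseen M R, (((s + 1 : ℕ) : ℝ) - (holders M n).card) *
          (((s : ℝ) - (holders M n).card) / (holders M n).card + 1) := by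
      rw [Finset.mul_sum]
      refine Finset.sum_le_sum fun n _ => ?_
      rcases Nat.eq_zero_or_pos (holders M n).card with h | h
      · simp only [h, Nat.cast_zero, div_zero, mul_zero, sub_zero]
        positivity
      · have : (0 : ℝ) < (holders M n).card := by exact_mod_cast h
        refine le_of_eq ?_
        field_simp
        ring
    have h4 := mul_le_mul_of_nonneg_left h3 hlog
    have h5 := h4.trans (h2.trans h1)
    push_cast at h5 ⊢
    rw [mul_left_comm, add_sub_cancel_right] at h5
    exact le_of_mul_le_mul_left h5 hs'

theorem IsScheme.sum_le_log_card [∀ i, Fintype (β i)] (hX : IsScheme M X) :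
    Real.log (Fintype.card A) * ∑ n, ((K : ℝ) - (holders M n).card) / (holders M n).card ≤
      Real.log (Fintype.card (∀ i, β i)) := by
  have h1 := hX.le_residualEntropy K ∅ (by simp)
  have h2 : residualEntropy M X ∅ = entropy fun v i => X i v := by
    unfold residualEntropy
    rw [entropy_of_subsingleton (f := fun (v : Fin K × Fin N → A) (p : known M ∅) => v p),
      sub_zero]
    · refine entropy_congr fun x y => ?_
      simp only [Prod.mk.injEq, restrict_eq_iff]
      simp [known]
    · intro x y
      rw [restrict_eq_iff]
      simp [known]
  rw [h2] at h1
  have h3 : unseen M ∅ = univ := by simp [unseen]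
  rw [h3] at h1
  exact h1.trans (entropy_le_log_card _)

end Converse

/-! ### From correct procedures to the entropy bound. -/

namespace Procedure

open Finset

variable {K N T : ℕ}

theorem Correct.decode_eq {P : Procedure K N T} (hP : P.Correct) (hK : 0 < K) (hT : 0 < T)
    (v : Fin K × Fin N → Bits T) (k : Fin K) :
    P.decode k (fun i => P.encode i fun p => v p) (fun p => v p) = fun n => v (k, n) := by
  -- A universal job: a file is the concatenation of its `K` IVAs and the maps read off the blocks,
  -- so every table `v` of IVAs occurs.
  let J : Job K N T :=
    { F := K * T
      F_pos := Nat.mul_pos hK hT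
      B := 1
      B_pos := one_pos
      mapFn := fun k _ x t => x (finProdFinEquiv (k, t))
      reduceFn := fun _ _ => 0 }
  let w : Fin N → Bits J.F := fun n j =>
    v ((finProdFinEquiv.symm j).1, n) (finProdFinEquiv.symm j).2
  have hw : ∀ k n, J.iva w k n = v (k, n) := by
    intro k n
    funext t
    change v ((finProdFinEquiv.symm (finProdFinEquiv (k, t))).1, n)
      (finProdFinEquiv.symm (finProdFinEquiv (k, t))).2 = _
    rw [Equiv.symm_apply_apply]
  have h := hP J w k
  have h1 : J.iva w k = fun n => v (k, n) := funext (hw k)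
  rw [h1] at h
  rw [← h]
  have h2 : ∀ i, P.localIVAs J w i =
      fun p : computed P.M P.Λ i => v p := fun i => funext fun p => hw p.1.1 p.1.2
  simp only [decoded, signal, h2]

theorem Correct.isScheme {P : Procedure K N T} (hP : P.Correct) (hK : 0 < K) (hT : 0 < T) :
    IsScheme P.M (fun i (v : Fin K × Fin N → Bits T) => P.encode i fun p => v p) where
  encode i v v' h := by
    congr 1
    funext ⟨⟨q, n⟩, hp⟩
    simp only [computed, mem_filter] at hp
    exact h q n hp.2.1
  decode k v v' h h' n := by
    have h1 := hP.decode_eq hK hT v k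
    have h2 := hP.decode_eq hK hT v' k
    have h3 : (fun p : computed P.M P.Λ k => v p) = fun p : computed P.M P.Λ k => v' p := by
      funext ⟨⟨q, n⟩, hp⟩
      simp only [computed, mem_filter] at hp
      exact h q n hp.2.1
    have h4 : (fun i => P.encode i fun p : computed P.M P.Λ i => v p) =
        fun i => P.encode i fun p : computed P.M P.Λ i => v' p :=
      funext h'
    rw [h3, h4, h2] at h1
    exact (congrFun h1 n).symm

theorem card_bits (m : ℕ) : Fintype.card (Bits m) = 2 ^ m := by
  simp [ZMod.card]

/-- Converse for the communication load in terms of the numbers of copies of the files. -/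
theorem Correct.le_communicationLoad {P : Procedure K N T} (hP : P.Correct) (hK : 0 < K)
    (hT : 0 < T) (hN : 0 < N) :
    (∑ n, (1 / ((holders P.M n).card : ℝ) - 1 / K)) / N ≤ P.communicationLoad := by
  have hX := hP.isScheme hK hT
  have h1 := hX.sum_le_log_card
  have hlog : 0 < Real.log 2 := Real.log_pos one_lt_two
  rw [card_bits, Fintype.card_pi] at h1
  simp only [card_bits, prod_pow_eq_pow_sum, Nat.cast_pow, Nat.cast_ofNat, Real.log_pow] at h1
  push_cast at h1
  have h2 : (T : ℝ) * ∑ n, ((K : ℝ) - (holders P.M n).card) / (holders P.M n).card ≤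
      ∑ k, (P.l k : ℝ) := by
    refine le_of_mul_le_mul_right ?_ hlog
    linarith
  have hK' : (0 : ℝ) < K := by exact_mod_cast hK
  have hT' : (0 : ℝ) < T := by exact_mod_cast hT
  have hN' : (0 : ℝ) < N := by exact_mod_cast hN
  have : Nontrivial (Bits T) := by
    have : Nonempty (Fin T) := ⟨⟨0, hT⟩⟩
    infer_instance
  have h3 : (T : ℝ) * ∑ n, ((K : ℝ) - (holders P.M n).card) / (holders P.M n).card =
      (K * T) * ∑ n, (1 / ((holders P.M n).card : ℝ) - 1 / K) := by
    rw [Finset.mul_sum, Finset.mul_sum]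
    refine Finset.sum_congr rfl fun n _ => ?_
    have : (0 : ℝ) < (holders P.M n).card := by
      exact_mod_cast card_pos.2 (hX.holders_nonempty hK n)
    field_simp
  rw [h3] at h2
  unfold communicationLoad
  rw [div_le_div_iff₀ hN' (by positivity)]
  nlinarith

theorem sum_card_holders (P : Procedure K N T) :
    ∑ n, ((holders P.M n).card : ℝ) = ∑ k, ((P.M k).card : ℝ) := by
  have := Finset.sum_card_bipartiteAbove_eq_sum_card_bipartiteBelow
    (s := (univ : Finset (Fin N))) (t := (univ : Finset (Fin K))) (fun n k => n ∈ P.M k)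
  simp only [bipartiteAbove, bipartiteBelow, filter_mem_eq_inter, univ_inter] at this
  exact_mod_cast this

end Procedure

open Finset

/-! ### Coded shuffling for a given placement of the files. -/

section Coding

variable {K N T : ℕ}

/-- Extension by zero of a family of IVAs. -/
def extendByZero {C : Finset (Fin K × Fin N)} (u : C → Bits T) (p : Fin K × Fin N) : Bits T :=
  if h : p ∈ C then u ⟨p, h⟩ else 0

theorem extendByZero_of_mem {C : Finset (Fin K × Fin N)} {v : Fin K × Fin N → Bits T}
    {p : Fin K × Fin N} (h : p ∈ C) : extendByZero (fun q : C => v q) p = v p := by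
  simp [extendByZero, h]

/-- Positions in the signal of node `i`: for each set `S` of nodes containing `i` there are
`B (|S| - 1)` bits that are useful to the other nodes in `S`. -/
abbrev Slot (B : ℕ → ℕ) (i : Fin K) : Type :=
  Σ S : {S : Finset (Fin K) // i ∈ S}, Fin (B (S.1.card - 1))

/-- The IVA bits `(q, n, t)` that node `i` adds up to form bit `j` of the part of its signal that
is addressed to `S`, where `A n` are the nodes storing file `n`, and bit `t` of every IVA of
file `n` is sent by node `s n t` in place `m n t`. -/
def slotTerms (A : Fin N → Finset (Fin K)) (s : Fin N → Fin T → Fin K) (m : Fin N → Fin T → ℕ)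
    (i : Fin K) (S : Finset (Fin K)) (j : ℕ) : Finset (Fin K × Fin N × Fin T) :=
  {x | x.1 ∉ A x.2.1 ∧ insert x.1 (A x.2.1) = S ∧ s x.2.1 x.2.2 = i ∧ m x.2.1 x.2.2 = j}

theorem mem_slotTerms {A : Fin N → Finset (Fin K)} {s : Fin N → Fin T → Fin K}
    {m : Fin N → Fin T → ℕ} {i : Fin K} {S : Finset (Fin K)} {j : ℕ}
    {x : Fin K × Fin N × Fin T} :
    x ∈ slotTerms A s m i S j ↔
      x.1 ∉ A x.2.1 ∧ insert x.1 (A x.2.1) = S ∧ s x.2.1 x.2.2 = i ∧ m x.2.1 x.2.2 = j := by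
  simp [slotTerms]

/-- The files stored at node `k` if file `n` is placed at the nodes in `A n`. -/
def placement (A : Fin N → Finset (Fin K)) (k : Fin K) : Finset (Fin N) := {n | k ∈ A n}

/-- Coded shuffling: node `k` computes its own IVAs and those of the nodes that lack the file. -/
noncomputable def codedProcedure (A : Fin N → Finset (Fin K)) (B : ℕ → ℕ)
    (s : Fin N → Fin T → Fin K) (m : Fin N → Fin T → ℕ) (hs : ∀ n t, s n t ∈ A n)
    (hm : ∀ n t, m n t < B (A n).card) : Procedure K N T where
  M := placement A
  Λ k n := insert k (A n)ᶜ
  l i := Fintype.card (Slot B i)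
  encode i u j :=
    ∑ y ∈ slotTerms A s m i ((Fintype.equivFin (Slot B i)).symm j).1
        ((Fintype.equivFin (Slot B i)).symm j).2,
      extendByZero u (y.1, y.2.1) y.2.2
  decode k X u n t :=
    if h : k ∈ A n then extendByZero u (k, n) t
    else
      X (s n t) (Fintype.equivFin (Slot B (s n t))
        ⟨⟨insert k (A n), mem_insert_of_mem (hs n t)⟩,
          ⟨m n t, by rw [card_insert_of_notMem h]; exact hm n t⟩⟩) -
      ∑ y ∈ slotTerms A s m (s n t) (insert k (A n)) (m n t) with y.1 ≠ k,
        extendByZero u (y.1, y.2.1) y.2.2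

variable {A : Fin N → Finset (Fin K)} {B : ℕ → ℕ} {s : Fin N → Fin T → Fin K}
  {m : Fin N → Fin T → ℕ} {hs : ∀ n t, s n t ∈ A n} {hm : ∀ n t, m n t < B (A n).card}

theorem codedProcedure_decode (k : Fin K)
    (X : ∀ i, Bits ((codedProcedure A B s m hs hm).l i))
    (u : computed (placement A) (fun k n => insert k (A n)ᶜ) k → Bits T) (n : Fin N) (t : Fin T) :
    (codedProcedure A B s m hs hm).decode k X u n t =
      if h : k ∈ A n then extendByZero u (k, n) t
      else
        X (s n t) (Fintype.equivFin (Slot B (s n t))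
          ⟨⟨insert k (A n), mem_insert_of_mem (hs n t)⟩,
            ⟨m n t, by rw [card_insert_of_notMem h]; exact hm n t⟩⟩) -
        ∑ y ∈ slotTerms A s m (s n t) (insert k (A n)) (m n t) with y.1 ≠ k,
          extendByZero u (y.1, y.2.1) y.2.2 :=
  rfl

theorem mem_computed_placement {k q : Fin K} {n : Fin N} :
    (q, n) ∈ computed (placement A) (fun k n => insert k (A n)ᶜ) k ↔
      k ∈ A n ∧ (q = k ∨ q ∉ A n) := by
  simp [computed, placement]

/-- In a sum addressed to `S`, a term wanted by another node of `S` belongs to a file that `k`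
stores, and its addressee lacks that file, so `k` has computed it. Injectivity of the slot
assignment leaves a single term wanted by `k`. -/
theorem codedProcedure_correct
    (hinj : ∀ n t n' t', A n = A n' → s n t = s n' t' → m n t = m n' t' → n = n' ∧ t = t') :
    (codedProcedure A B s m hs hm).Correct := by
  intro J w k
  funext n t
  set v : Fin K × Fin N → Bits T := fun p => J.iva w p.1 p.2 with hv
  have hloc : ∀ k, (codedProcedure A B s m hs hm).localIVAs J w k =
      fun p : computed (placement A) (fun k n => insert k (A n)ᶜ) k => v p := fun k => rfl
  change (codedProcedure A B s m hs hm).decode k _ _ n t = v (k, n) t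
  rw [hloc]
  rw [codedProcedure_decode]
  split_ifs with h
  · rw [extendByZero_of_mem (mem_computed_placement.2 ⟨h, Or.inl rfl⟩)]
  · have hsig : ∀ x : Slot B (s n t),
        (codedProcedure A B s m hs hm).signal J w (s n t) (Fintype.equivFin _ x) =
        ∑ y ∈ slotTerms A s m (s n t) x.1 x.2, v (y.1, y.2.1) y.2.2 := by
      intro x
      rw [Procedure.signal, hloc]
      change ∑ y ∈ slotTerms A s m (s n t)
        ((Fintype.equivFin (Slot B (s n t))).symm (Fintype.equivFin _ x)).1
        ((Fintype.equivFin (Slot B (s n t))).symm (Fintype.equivFin _ x)).2, extendByZero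
          (fun p : computed (placement A) (fun k n => insert k (A n)ᶜ) (s n t) => v p)
          (y.1, y.2.1) y.2.2 = _
      rw [Equiv.symm_apply_apply]
      refine Finset.sum_congr rfl fun y hy => ?_
      rw [mem_slotTerms] at hy
      rw [extendByZero_of_mem (mem_computed_placement.2 ⟨hy.2.2.1 ▸ hs _ _, Or.inr hy.1⟩)]
    have hside : ∑ y ∈ slotTerms A s m (s n t) (insert k (A n)) (m n t) with y.1 ≠ k,
        extendByZero (fun p : computed (placement A) (fun k n => insert k (A n)ᶜ) k => v p)
          (y.1, y.2.1) y.2.2 =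
        ∑ y ∈ slotTerms A s m (s n t) (insert k (A n)) (m n t) with y.1 ≠ k,
          v (y.1, y.2.1) y.2.2 := by
      refine Finset.sum_congr rfl fun y hy => ?_
      rw [mem_filter, mem_slotTerms] at hy
      have hk : k ∈ insert y.1 (A y.2.1) := by rw [hy.1.2.1]; exact mem_insert_self _ _
      rw [extendByZero_of_mem (mem_computed_placement.2
        ⟨(mem_insert.1 hk).resolve_left (Ne.symm hy.2), Or.inr hy.1.1⟩)]
    have huniq : {y ∈ slotTerms A s m (s n t) (insert k (A n)) (m n t) | y.1 = k} =
        {(k, n, t)} := by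
      ext ⟨q, n', t'⟩
      simp only [mem_filter, mem_slotTerms, mem_singleton, Prod.mk.injEq]
      constructor
      · rintro ⟨⟨h1, h2, h3, h4⟩, rfl⟩
        -- Both holder sets are `S` with `k` removed, so `hinj` applies.
        have hA : A n' = A n := by
          rw [← erase_insert h1, h2, erase_insert h]
        obtain ⟨rfl, rfl⟩ := hinj _ _ _ _ hA h3 h4
        exact ⟨rfl, rfl, rfl⟩
      · rintro ⟨rfl, rfl, rfl⟩
        exact ⟨⟨h, rfl, rfl, rfl⟩, rfl⟩
    refine (congrArg₂ (· - ·) (hsig _) hside).trans ?_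
    dsimp only
    rw [← Finset.sum_filter_add_sum_filter_not _ (fun y : Fin K × Fin N × Fin T => y.1 = k), huniq,
      sum_singleton, add_sub_cancel_right]

/-- For each `S`, the bit positions of the files stored exactly at `S` are injected into pairs of a
sender in `S` and one of its `B S.card` places. The same assignment serves all receivers outside
`S`. -/
theorem exists_slot_assignment (A : Fin N → Finset (Fin K)) (B : ℕ → ℕ)
    (hB : ∀ S, ({n | A n = S} : Finset (Fin N)).card * T ≤ S.card * B S.card) :
    ∃ (s : Fin N → Fin T → Fin K) (m : Fin N → Fin T → ℕ),
      (∀ n t, s n t ∈ A n) ∧ (∀ n t, m n t < B (A n).card) ∧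
      ∀ n t n' t', A n = A n' → s n t = s n' t' → m n t = m n' t' → n = n' ∧ t = t' := by
  have he : ∀ S, Nonempty (({n // A n = S} × Fin T) ↪ (S × Fin (B S.card))) := by
    intro S
    refine Function.Embedding.nonempty_of_card_le ?_
    simpa [Fintype.card_subtype] using hB S
  let E : ∀ S, ({n // A n = S} × Fin T) ↪ (S × Fin (B S.card)) :=
    fun S => (he S).some
  refine ⟨fun n t => (E (A n) (⟨n, rfl⟩, t)).1, fun n t => (E (A n) (⟨n, rfl⟩, t)).2,
    fun n t => (E (A n) (⟨n, rfl⟩, t)).1.2, fun n t => (E (A n) (⟨n, rfl⟩, t)).2.2, ?_⟩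
  intro n t n' t' hA
  have key : ∀ S (hn : A n = S) (hn' : A n' = S),
      ((E S (⟨n, hn⟩, t)).1 : Fin K) = (E S (⟨n', hn'⟩, t')).1 →
      ((E S (⟨n, hn⟩, t)).2 : ℕ) = (E S (⟨n', hn'⟩, t')).2 → n = n' ∧ t = t' := by
    intro S hn hn' h1 h2
    have := (E S).injective (Prod.ext (Subtype.ext h1) (Fin.ext h2))
    simpa using this
  have htr : ∀ S (hn' : A n' = S),
      ((E (A n') (⟨n', rfl⟩, t')).1 : Fin K) = (E S (⟨n', hn'⟩, t')).1 ∧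
      ((E (A n') (⟨n', rfl⟩, t')).2 : ℕ) = (E S (⟨n', hn'⟩, t')).2 := by
    rintro S rfl
    exact ⟨rfl, rfl⟩
  intro h1 h2
  have h3 := htr (A n) hA.symm
  exact key (A n) rfl hA.symm (h1.trans h3.1) (h2.trans h3.2)

theorem sum_card_slot (B : ℕ → ℕ) :
    ∑ i : Fin K, Fintype.card (Slot B i) =
      ∑ S : Finset (Fin K), S.card * B (S.card - 1) := by
  have h : ∀ i : Fin K, Fintype.card (Slot B i) =
      ∑ S : Finset (Fin K), if i ∈ S then B (S.card - 1) else 0 := by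
    intro i
    rw [Fintype.card_sigma, ← Finset.sum_filter]
    simp only [Fintype.card_fin]
    exact (Finset.sum_subtype _ (by simp) (fun S : Finset (Fin K) => B (S.card - 1))).symm
  simp_rw [h]
  rw [Finset.sum_comm]
  refine Finset.sum_congr rfl fun S _ => ?_
  rw [← Finset.sum_filter, Finset.sum_const, smul_eq_mul]
  simp

theorem sum_card_placement (A : Fin N → Finset (Fin K)) :
    ∑ k, (placement A k).card = ∑ n, (A n).card := by
  have := Finset.sum_card_bipartiteAbove_eq_sum_card_bipartiteBelow
    (s := (univ : Finset (Fin K))) (t := (univ : Finset (Fin N))) (fun k n => k ∈ A n)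
  simpa only [bipartiteAbove, bipartiteBelow, filter_mem_eq_inter, univ_inter, placement] using this

/-- Each holder of a file computes its own IVA and one for every non-holder. -/
theorem sum_card_computed_placement (A : Fin N → Finset (Fin K)) :
    ∑ k, (computed (placement A) (fun k n => insert k (A n)ᶜ) k).card =
      ∑ n, (A n).card * (K - (A n).card + 1) := by
  have h : ∀ k, (computed (placement A) (fun k n => insert k (A n)ᶜ) k).card =
      ∑ n, if k ∈ A n then K - (A n).card + 1 else 0 := by
    intro k
    rw [Finset.card_eq_sum_card_fiberwise (f := Prod.snd) (t := univ) (fun _ _ => by simp)]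
    refine Finset.sum_congr rfl fun n _ => ?_
    split_ifs with hk
    · have : {p ∈ computed (placement A) (fun k n => insert k (A n)ᶜ) k | p.2 = n} =
          (insert k (A n)ᶜ).image fun q => (q, n) := by
        ext ⟨q, n'⟩
        simp only [mem_filter, mem_computed_placement, mem_image, mem_insert, mem_compl,
          Prod.mk.injEq]
        grind
      rw [this, card_image_of_injective _ (fun a b h => (Prod.mk.inj h).1),
        card_insert_of_notMem (by simpa using hk), card_compl, Fintype.card_fin]
    · rw [card_eq_zero, filter_eq_empty_iff]
      rintro ⟨q, n'⟩ hp rfl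
      exact hk (mem_computed_placement.1 hp).1
  simp_rw [h]
  rw [Finset.sum_comm]
  refine Finset.sum_congr rfl fun n _ => ?_
  rw [← Finset.sum_filter, Finset.sum_const, smul_eq_mul]
  simp

theorem exists_coded_procedure (A : Fin N → Finset (Fin K)) (B : ℕ → ℕ)
    (hB : ∀ S, ({n | A n = S} : Finset (Fin N)).card * T ≤ S.card * B S.card) :
    ∃ P : Procedure K N T, P.Correct ∧ ∑ k, (P.M k).card = ∑ n, (A n).card ∧
      ∑ k, (computed P.M P.Λ k).card = ∑ n, (A n).card * (K - (A n).card + 1) ∧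
      ∑ k, P.l k = ∑ S : Finset (Fin K), S.card * B (S.card - 1) := by
  obtain ⟨s, m, hs, hm, hinj⟩ := exists_slot_assignment A B hB
  exact ⟨codedProcedure A B s m hs hm, codedProcedure_correct hinj, sum_card_placement A,
    sum_card_computed_placement A, sum_card_slot B⟩

end Coding

/-! ### Spreading files evenly over node sets, and the resulting loads. -/

theorem exists_map_card_fiber_le {α : Type*} [Fintype α] [DecidableEq α] {N : ℕ} (c : α → ℕ)
    (hc : N ≤ ∑ a, c a) :
    ∃ f : Fin N → α, ∀ a, ({n | f n = a} : Finset (Fin N)).card ≤ c a := by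
  obtain ⟨e⟩ : Nonempty (Fin N ↪ Σ a, Fin (c a)) :=
    Function.Embedding.nonempty_of_card_le (by simpa using hc)
  refine ⟨fun n => (e n).1, fun a => ?_⟩
  have key : ∀ x : Σ a, Fin (c a), x.1 = a →
      x ∈ (univ : Finset (Fin (c a))).image (Sigma.mk a) := by
    rintro ⟨_, b⟩ rfl
    simp
  calc ({n | (e n).1 = a} : Finset (Fin N)).card
      ≤ ((univ : Finset (Fin (c a))).image (Sigma.mk a)).card :=
        Finset.card_le_card_of_injOn e (fun n hn => key _ (by simpa using hn)) e.injective.injOn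
    _ ≤ c a := card_image_le.trans (by simp)

theorem sum_finset_card (K : ℕ) (f : ℕ → ℝ) :
    ∑ S : Finset (Fin K), f S.card = ∑ j ∈ range (K + 1), (K.choose j : ℝ) * f j := by
  have := Finset.sum_powerset_apply_card f (x := (univ : Finset (Fin K)))
  simpa using this

/-- The shift by one uses `(j + 1) * choose K (j + 1) = (K - j) * choose K j`. -/
theorem sum_finset_card_pred (K : ℕ) (f : ℕ → ℝ) :
    ∑ S : Finset (Fin K), (S.card : ℝ) * f (S.card - 1) =
      ∑ j ∈ range (K + 1), (K.choose j : ℝ) * (((K : ℝ) - j) * f j) := by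
  rw [sum_finset_card K (fun j => (j : ℝ) * f (j - 1)), Finset.sum_range_succ',
    Finset.sum_range_succ]
  simp only [Nat.cast_zero, zero_mul, mul_zero, add_zero, sub_self]
  refine Finset.sum_congr rfl fun j hj => ?_
  have h := Nat.choose_succ_right_eq K j
  have hj' : j ≤ K := (mem_range.1 hj).le
  have h' : (K.choose (j + 1) : ℝ) * ((j + 1 : ℕ) : ℝ) = K.choose j * ((K : ℝ) - j) := by
    rw [← Nat.cast_sub hj']
    exact_mod_cast h
  rw [Nat.add_sub_cancel, ← mul_assoc, h', mul_assoc]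

open Finset

theorem sum_comp_le_of_fiber_le {K N : ℕ} {A : Fin N → Finset (Fin K)} {c : ℕ → ℝ}
    (hA : ∀ S, ((({n | A n = S} : Finset (Fin N)).card : ℕ) : ℝ) ≤ c S.card) {g : ℕ → ℝ}
    (hg : ∀ j, 0 ≤ g j) :
    ∑ n, g (A n).card ≤ ∑ S : Finset (Fin K), c S.card * g S.card := by
  rw [← Finset.sum_fiberwise (s := univ) (g := A)]
  refine Finset.sum_le_sum fun S _ => ?_
  rw [Finset.sum_congr rfl (g := fun _ => g S.card) (fun n hn => by rw [(mem_filter.1 hn).2]),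
    Finset.sum_const, nsmul_eq_mul]
  exact mul_le_mul_of_nonneg_right (hA S) (hg _)

theorem sum_weight_mul {K : ℕ} (p g : ℕ → ℝ) :
    ∑ S : Finset (Fin K), p S.card / K.choose S.card * g S.card =
      ∑ j ∈ range (K + 1), p j * g j := by
  rw [sum_finset_card K (fun j => p j / K.choose j * g j)]
  refine Finset.sum_congr rfl fun j hj => ?_
  have : (K.choose j : ℝ) ≠ 0 := by
    exact_mod_cast (Nat.choose_pos (Nat.lt_succ_iff.1 (mem_range.1 hj))).ne'
  field_simp

theorem sum_weight_mul_pred {K : ℕ} (p g : ℕ → ℝ) :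
    ∑ S : Finset (Fin K), (S.card : ℝ) *
        (p (S.card - 1) / K.choose (S.card - 1) * g (S.card - 1)) =
      ∑ j ∈ range (K + 1), p j * (((K : ℝ) - j) * g j) := by
  rw [sum_finset_card_pred K (fun j => p j / K.choose j * g j)]
  refine Finset.sum_congr rfl fun j hj => ?_
  have : (K.choose j : ℝ) ≠ 0 := by
    exact_mod_cast (Nat.choose_pos (Nat.lt_succ_iff.1 (mem_range.1 hj))).ne'
  field_simp

/-- The coded procedure in which a fraction `p j` of the files is stored at `j` nodes, with loads
in absolute terms. -/
theorem exists_procedure_of_distribution {K : ℕ} {p : ℕ → ℝ} (hp : ∀ j, 0 ≤ p j)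
    (hp0 : p 0 = 0) (hp1 : ∑ j ∈ range (K + 1), p j = 1) (N T : ℕ) :
    ∃ P : Procedure K N T, P.Correct ∧
      ∑ k, ((P.M k).card : ℝ) ≤
        N * ∑ j ∈ range (K + 1), p j * j + ∑ S : Finset (Fin K), (S.card : ℝ) ∧
      ∑ k, ((computed P.M P.Λ k).card : ℝ) ≤
        N * ∑ j ∈ range (K + 1), p j * (j * ((K - j : ℕ) + 1)) +
          ∑ S : Finset (Fin K), (S.card : ℝ) * ((K - S.card : ℕ) + 1) ∧
      ∑ k, (P.l k : ℝ) ≤ N * T * ∑ j ∈ range (K + 1), p j * (((K : ℝ) - j) * (1 / j)) +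
        (T + 1) * ∑ S : Finset (Fin K), (S.card : ℝ) := by
  -- `c j` is the number of files allotted to each set of size `j`; `B j` is the number of their
  -- bits assigned to each of its `j` members. Both are rounded up, and `p 0 = 0` makes `c 0` and `B
  -- 0` vanish.
  set c : ℕ → ℕ := fun j => ⌈p j / K.choose j * N⌉₊ with hc
  set B : ℕ → ℕ := fun j => ⌈(c j * T : ℝ) / j⌉₊ with hB
  have hw : ∀ j, 0 ≤ p j / K.choose j := fun j => div_nonneg (hp j) (Nat.cast_nonneg _)
  have hcsum : N ≤ ∑ S : Finset (Fin K), c S.card := by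
    have h1 : ∑ S : Finset (Fin K), p S.card / K.choose S.card = 1 := by
      have := sum_weight_mul (K := K) p (fun _ => 1)
      simpa only [mul_one, hp1] using this
    have h2 : (N : ℝ) ≤ ∑ S : Finset (Fin K), (c S.card : ℝ) := by
      calc (N : ℝ) = ∑ S : Finset (Fin K), p S.card / K.choose S.card * N := by
            rw [← Finset.sum_mul, h1, one_mul]
        _ ≤ _ := Finset.sum_le_sum fun S _ => Nat.le_ceil _
    exact_mod_cast h2
  obtain ⟨A, hA⟩ := exists_map_card_fiber_le (fun S : Finset (Fin K) => c S.card) hcsum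
  have hcle : ∀ j, (c j : ℝ) ≤ p j / K.choose j * N + 1 := fun j =>
    (Nat.ceil_lt_add_one (mul_nonneg (hw j) (Nat.cast_nonneg _))).le
  have hc0 : c 0 = 0 := by simp [hc, hp0]
  obtain ⟨P, hP, hM, hC, hl⟩ := exists_coded_procedure (T := T) A B (by
    intro S
    rcases S.eq_empty_or_nonempty with rfl | hS
    · have := hA ∅
      simp only [card_empty, hc0, Nat.le_zero] at this
      simp [this]
    · have hS' : (0 : ℝ) < S.card := by exact_mod_cast hS.card_pos
      have h1 : (c S.card * T : ℝ) / S.card ≤ B S.card := Nat.le_ceil _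
      rw [div_le_iff₀' hS'] at h1
      exact (Nat.mul_le_mul_right _ (hA S)).trans (by exact_mod_cast h1))
  have hA' : ∀ S, ((({n | A n = S} : Finset (Fin N)).card : ℕ) : ℝ) ≤
      p S.card / K.choose S.card * N + 1 :=
    fun S => (Nat.cast_le.2 (hA S)).trans (hcle _)
  have hload : ∀ g : ℕ → ℝ, (∀ j, 0 ≤ g j) → ∑ n, g (A n).card ≤
      N * ∑ j ∈ range (K + 1), p j * g j + ∑ S : Finset (Fin K), g S.card := by
    intro g hg
    refine (sum_comp_le_of_fiber_le (c := fun j => p j / K.choose j * N + 1) hA' hg).trans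
      (le_of_eq ?_)
    rw [← sum_weight_mul, Finset.mul_sum, ← Finset.sum_add_distrib]
    exact Finset.sum_congr rfl fun S _ => by ring
  refine ⟨P, hP, ?_, ?_, ?_⟩
  · have h := hload (fun j => (j : ℝ)) fun j => Nat.cast_nonneg j
    rw [← Nat.cast_sum, hM, Nat.cast_sum]
    exact h
  · have h := hload (fun j => (j : ℝ) * ((K - j : ℕ) + 1)) fun j => by positivity
    rw [← Nat.cast_sum, hC, Nat.cast_sum]
    push_cast
    exact h
  · have hBle : ∀ j, (B j : ℝ) ≤ N * T * (p j / K.choose j * (1 / j)) + (T + 1) := by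
      intro j
      have h1 : (B j : ℝ) ≤ (c j * T : ℝ) / j + 1 := (Nat.ceil_lt_add_one (by positivity)).le
      rcases Nat.eq_zero_or_pos j with rfl | hj
      · simp only [Nat.cast_zero, div_zero, mul_zero, zero_add] at h1 ⊢
        have : (0 : ℝ) ≤ T := Nat.cast_nonneg T
        linarith
      have hj' : (1 : ℝ) ≤ j := by exact_mod_cast hj
      have h2 : (c j * T : ℝ) / j ≤ (p j / K.choose j * N + 1) * T / j := by
        gcongr
        exact hcle j
      have h3 : (T : ℝ) / j ≤ T := div_le_self (Nat.cast_nonneg T) hj'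
      have h4 : (p j / K.choose j * N + 1) * T / j =
          N * T * (p j / K.choose j * (1 / j)) + T / j := by ring
      linarith
    rw [← Nat.cast_sum, hl, Nat.cast_sum, ← sum_weight_mul_pred, Finset.mul_sum, Finset.mul_sum,
      ← Finset.sum_add_distrib]
    refine Finset.sum_le_sum fun S _ => ?_
    have := mul_le_mul_of_nonneg_left (hBle (S.card - 1)) (Nat.cast_nonneg (α := ℝ) S.card)
    push_cast
    linarith

/-- Since `t ≥ 1`, the rounding term is at most `2 * d * t`, so after division it is small uniformly
in `t`. This is what permits an arbitrary sequence of IVA lengths. -/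
theorem load_div_le {a n k t x d ε : ℝ} (hn : 0 < n) (hk : 1 ≤ k) (ht : 1 ≤ t) (hd : 0 ≤ d)
    (hε : 2 * d ≤ n * ε * k) (ha : a ≤ n * t * x + (t + 1) * d) :
    a / (n * k * t) ≤ x / k + ε := by
  have hk' : 0 < k := by linarith
  have ht' : 0 < t := by linarith
  rw [div_le_iff₀ (by positivity)]
  have h1 : (x / k + ε) * (n * k * t) = n * t * x + (n * ε * k) * t := by
    field_simp
  have h2 : (t + 1) * d ≤ 2 * d * t := by nlinarith
  have h3 : 2 * d * t ≤ (n * ε * k) * t := by gcongr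
  linarith

theorem achievable_of_distribution {K : ℕ} (hK : 0 < K) {T : ℕ → ℕ} (hT : ∀ N, 0 < T N)
    {p : ℕ → ℝ} (hp : ∀ j, 0 ≤ p j) (hp0 : p 0 = 0)
    (hp1 : ∑ j ∈ range (K + 1), p j = 1) :
    Achievable K T (∑ j ∈ range (K + 1), p j * j)
      ((∑ j ∈ range (K + 1), p j * (j * ((K - j : ℕ) + 1))) / K)
      ((∑ j ∈ range (K + 1), p j * (((K : ℝ) - j) * (1 / j))) / K) := by
  intro ε hε
  set D₁ : ℝ := ∑ S : Finset (Fin K), (S.card : ℝ) with hD₁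
  set D₂ : ℝ := ∑ S : Finset (Fin K), (S.card : ℝ) * ((K - S.card : ℕ) + 1) with hD₂
  have h1 : 0 ≤ D₁ := Finset.sum_nonneg fun S _ => Nat.cast_nonneg _
  have h2 : 0 ≤ D₂ := Finset.sum_nonneg fun S _ => by positivity
  refine ⟨⌈(2 * D₁ + D₂) / ε⌉₊ + 1, Nat.succ_pos _, fun N hN => ?_⟩
  obtain ⟨P, hP, hM, hC, hl⟩ := exists_procedure_of_distribution hp hp0 hp1 N (T N)
  have hN' : 0 < N := by omega
  have hNε : 2 * D₁ + D₂ ≤ N * ε := by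
    rw [← div_le_iff₀ hε]
    refine (Nat.le_ceil _).trans ?_
    exact_mod_cast (by omega : ⌈(2 * D₁ + D₂) / ε⌉₊ ≤ N)
  have hNr : (0 : ℝ) < N := by exact_mod_cast hN'
  have hKr : (1 : ℝ) ≤ K := by exact_mod_cast hK
  have hTr : (1 : ℝ) ≤ T N := by exact_mod_cast hT N
  have hNK : N * ε ≤ N * ε * K := le_mul_of_one_le_right (by positivity) hKr
  refine ⟨P, hP, ?_, ?_, ?_⟩
  · unfold Procedure.storageSpace
    rw [div_le_iff₀ hNr]
    linarith
  · unfold Procedure.computationLoad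
    rw [div_add' _ _ _ (by positivity), div_le_div_iff₀ (by positivity) (by positivity)]
    nlinarith
  · unfold Procedure.communicationLoad
    exact load_div_le hNr hKr hTr h1 (by linarith) hl

/-! ### The convex envelope and the converse in terms of storage space. -/

/-- The chord of `x ↦ 1 / x - 1 / K` through its points at `i` and `i + 1`. -/
noncomputable def chord (K i : ℕ) (x : ℝ) : ℝ :=
  1 / i - 1 / K - (x - i) / (i * (i + 1))

theorem chord_le {i j : ℕ} (K : ℕ) (hi : 1 ≤ i) (hj : 1 ≤ j) :
    chord K i j ≤ 1 / (j : ℝ) - 1 / K := by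
  have hi' : (0 : ℝ) < i := by exact_mod_cast hi
  have hj' : (0 : ℝ) < j := by exact_mod_cast hj
  -- No integer lies strictly between `i` and `i + 1`.
  have h : 0 ≤ ((j : ℝ) - i) * (j - i - 1) := by
    rcases le_or_gt j i with h | h
    · have : (j : ℝ) ≤ i := by exact_mod_cast h
      nlinarith
    · have : (i : ℝ) + 1 ≤ j := by exact_mod_cast h
      nlinarith
  have h' : 1 / (j : ℝ) - 1 / K - chord K i j =
      ((j : ℝ) - i) * (j - i - 1) / (i * j * (i + 1)) := by
    unfold chord
    field_simp
    ring
  have : 0 ≤ ((j : ℝ) - i) * (j - i - 1) / (i * j * (i + 1)) := by positivity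
  linarith

/-- The value is attained by mixing two neighbouring points; conversely the half-plane above the
chord is convex and contains all the points. -/
theorem storageOptimum_eq_chord {K i : ℕ} (hi : 1 ≤ i) (hiK : i + 1 ≤ K) {r : ℝ}
    (hir : (i : ℝ) ≤ r) (hri : r ≤ i + 1) : storageOptimum K r = chord K i r := by
  have hK : (0 : ℝ) < K := by exact_mod_cast (by omega : 0 < K)
  have hi' : (0 : ℝ) < i := by exact_mod_cast hi
  set S : Set (ℝ × ℝ) :=
    {p | ∃ i : ℕ, 1 ≤ i ∧ i ≤ K ∧ p = ((i : ℝ), 1 / (i : ℝ) * (1 - (i : ℝ) / K))} with hS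
  have hpoint : ∀ j : ℕ, 1 ≤ j → 1 / (j : ℝ) * (1 - (j : ℝ) / K) = 1 / j - 1 / K := by
    intro j hj
    have : (0 : ℝ) < j := by exact_mod_cast hj
    field_simp
  suffices IsLeast {y : ℝ | (r, y) ∈ convexHull ℝ S} (chord K i r) from this.csInf_eq
  constructor
  · have h1 : ((i : ℝ), 1 / (i : ℝ) * (1 - (i : ℝ) / K)) ∈ convexHull ℝ S :=
      subset_convexHull ℝ S ⟨i, hi, by omega, rfl⟩
    have h2 : (((i + 1 : ℕ) : ℝ), 1 / ((i + 1 : ℕ) : ℝ) * (1 - ((i + 1 : ℕ) : ℝ) / K)) ∈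
        convexHull ℝ S := subset_convexHull ℝ S ⟨i + 1, by omega, hiK, rfl⟩
    have h3 := convex_convexHull ℝ S h1 h2 (a := 1 - (r - i)) (b := r - i) (by linarith)
      (by linarith) (by ring)
    rw [hpoint i hi, hpoint (i + 1) (by omega)] at h3
    change (r, chord K i r) ∈ convexHull ℝ S
    convert h3 using 1
    refine Prod.ext ?_ ?_
    · simp
      ring
    · simp only [chord, Prod.smul_mk, smul_eq_mul, Prod.mk_add_mk]
      push_cast
      field_simp
      ring
  · intro y hy
    have hconv : Convex ℝ {q : ℝ × ℝ | chord K i q.1 ≤ q.2} := by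
      intro a ha b hb s t hs ht hst
      simp only [Set.mem_ofPred_eq, chord, Prod.fst_add, Prod.snd_add, Prod.smul_fst, Prod.smul_snd,
        smul_eq_mul] at ha hb ⊢
      have h1 := mul_le_mul_of_nonneg_left ha hs
      have h2 := mul_le_mul_of_nonneg_left hb ht
      have h3 : (1 / i - 1 / K - (s * a.1 + t * b.1 - i) / (i * (i + 1)) : ℝ) =
          s * (1 / i - 1 / K - (a.1 - i) / (i * (i + 1))) +
            t * (1 / i - 1 / K - (b.1 - i) / (i * (i + 1))) := by
        obtain rfl : s = 1 - t := by linarith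
        ring
      linarith
    have hsub : S ⊆ {q : ℝ × ℝ | chord K i q.1 ≤ q.2} := by
      rintro _ ⟨j, hj, -, rfl⟩
      simp only [Set.mem_ofPred_eq]
      rw [hpoint j hj]
      exact chord_le K hi hj
    exact convexHull_min hsub hconv hy

/-- As `chord` is affine, its average over the holder counts is its value at their mean, the storage
space. -/
theorem Procedure.Correct.chord_storageSpace_le {K N T i : ℕ} {P : Procedure K N T}
    (hP : P.Correct) (hK : 0 < K) (hN : 0 < N) (hT : 0 < T) (hi : 1 ≤ i) :
    chord K i P.storageSpace ≤ P.communicationLoad := by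
  refine le_trans ?_ (hP.le_communicationLoad hK hT hN)
  have hN' : (0 : ℝ) < N := by exact_mod_cast hN
  have : Nontrivial (Bits T) := by
    have : Nonempty (Fin T) := ⟨⟨0, hT⟩⟩
    infer_instance
  have h1 : ∑ n, chord K i ((holders P.M n).card : ℝ) ≤
      ∑ n, (1 / ((holders P.M n).card : ℝ) - 1 / K) := Finset.sum_le_sum fun n _ =>
    chord_le K hi (card_pos.2 ((hP.isScheme hK hT).holders_nonempty hK n))
  refine le_trans (le_of_eq ?_) (div_le_div_of_nonneg_right h1 hN'.le)
  unfold chord Procedure.storageSpace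
  rw [← P.sum_card_holders]
  simp only [Finset.sum_sub_distrib, ← Finset.sum_div, Finset.sum_const, card_univ,
    Fintype.card_fin, nsmul_eq_mul]
  field_simp

theorem Achievable.storageOptimum_le {K : ℕ} {T : ℕ → ℕ} (hT : ∀ N, 0 < T N) {i : ℕ}
    (hi : 1 ≤ i) (hiK : i + 1 ≤ K) {r c L : ℝ} (hir : (i : ℝ) ≤ r) (hri : r ≤ i + 1)
    (h : Achievable K T r c L) : storageOptimum K r ≤ L := by
  rw [storageOptimum_eq_chord hi hiK hir hri]
  refine le_of_forall_pos_le_add fun ε hε => ?_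
  obtain ⟨N, hN, hN'⟩ := h (ε / 2) (half_pos hε)
  obtain ⟨P, hP, hs, -, hL⟩ := hN' N le_rfl
  have h1 := hP.chord_storageSpace_le (by omega) hN (hT N) hi
  have hi' : (1 : ℝ) ≤ i := by exact_mod_cast hi
  -- The chord has slope `-1 / (i * (i + 1))`, of absolute value below `1`, so the storage excess `ε
  -- / 2` costs at most `ε / 2`.
  have h2 : chord K i r ≤ chord K i P.storageSpace + ε / 2 := by
    have h3 : (P.storageSpace - r) / (i * (i + 1)) ≤ ε / 2 := by
      rw [div_le_iff₀ (by positivity)]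
      nlinarith [mul_pos hε (by linarith : (0 : ℝ) < i)]
    have h4 : chord K i r = chord K i P.storageSpace +
        (P.storageSpace - r) / (i * (i + 1)) := by
      unfold chord
      ring
    linarith
  linarith

/-! ### The two-point mixture attaining the optimum. -/

theorem sum_range_two_point {K i : ℕ} (hiK : i + 1 ≤ K) (a b : ℝ) (g : ℕ → ℝ) :
    ∑ j ∈ range (K + 1), (if j = i then a else if j = i + 1 then b else 0) * g j =
      a * g i + b * g (i + 1) := by
  have h : ∀ j, (if j = i then a else if j = i + 1 then b else 0) * g j =
      (if j = i then a * g i else 0) + (if j = i + 1 then b * g (i + 1) else 0) := by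
    intro j
    by_cases h1 : j = i
    · subst h1
      simp
    · by_cases h2 : j = i + 1
      · subst h2
        simp
      · simp [h1, h2]
  simp_rw [h]
  rw [Finset.sum_add_distrib, Finset.sum_ite_eq', Finset.sum_ite_eq', if_pos, if_pos] <;>
    simp only [mem_range] <;> omega

theorem cStar_eq {K i : ℕ} {r : ℝ} (hir : (i : ℝ) ≤ r) (hri : r < i + 1) (hrK : r < K) :
    cStar K r = (i * (K - i + 1) + (r - i) * (K - 2 * i)) / K := by
  have hfl : ⌊r⌋ = (i : ℤ) := Int.floor_eq_iff.2 ⟨by exact_mod_cast hir, by exact_mod_cast hri⟩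
  have hK : (0 : ℝ) < K := by
    have : (0 : ℝ) ≤ i := Nat.cast_nonneg i
    linarith
  have hKr : (K : ℝ) - r ≠ 0 := by linarith
  -- At `r = i` the ceiling is `i` rather than `i + 1`, but the factor `r - i` vanishes.
  have hce : (r - i) * ((K : ℝ) - (⌈r⌉ : ℝ)) = (r - i) * ((K : ℝ) - (i + 1)) := by
    rcases hir.eq_or_lt with h | h
    · simp [h]
    · have : ⌈r⌉ = (i : ℤ) + 1 := Int.ceil_eq_iff.2
        ⟨by push_cast; linarith, by push_cast; linarith⟩
      rw [this]
      push_cast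
      rfl
  unfold cStar gThreshold
  rw [hfl]
  push_cast
  rw [hce]
  field_simp
  ring

theorem achievable_cStar_storageOptimum {K : ℕ} {T : ℕ → ℕ} (hT : ∀ N, 0 < T N) {i : ℕ}
    (hi : 1 ≤ i) (hiK : i + 1 ≤ K) {r : ℝ} (hir : (i : ℝ) ≤ r) (hri : r < i + 1)
    (hrK : r < K) : Achievable K T r (cStar K r) (storageOptimum K r) := by
  have hi' : (0 : ℝ) < i := by exact_mod_cast hi
  have hK' : (0 : ℝ) < K := by exact_mod_cast (by omega : 0 < K)
  have h := achievable_of_distribution (K := K) (by omega) hT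
    -- The weights on `i` and `i + 1` with mean `r`.
    (p := fun j => if j = i then 1 - (r - i) else if j = i + 1 then r - i else 0)
    (fun j => by
      split_ifs <;> linarith)
    (by simp [show (0 : ℕ) ≠ i by omega])
    (by simpa using sum_range_two_point hiK (1 - (r - i)) (r - i) (fun _ => 1))
  rw [sum_range_two_point hiK, sum_range_two_point hiK, sum_range_two_point hiK,
    Nat.cast_sub hiK, Nat.cast_sub (by omega : i ≤ K)] at h
  rw [cStar_eq hir hri hrK, storageOptimum_eq_chord hi hiK hir hri.le]
  convert h using 1
  · push_cast
    ring
  · push_cast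
    ring
  · unfold chord
    push_cast
    field_simp
    ring

end MapReduce

theorem corollary1 (K : ℕ) (T : ℕ → ℕ) (hT : ∀ N, 0 < T N) (r : ℝ) (hr : 1 ≤ r)
    (hrK : r < (K : ℝ)) :
    (∀ c : ℝ, MapReduce.cStar K r ≤ c → c ≤ r →
      MapReduce.optimalLoad K T r c = MapReduce.storageOptimum K r) ∧
    MapReduce.Achievable K T r (MapReduce.cStar K r) (MapReduce.storageOptimum K r) ∧
    (∀ c L : ℝ, MapReduce.Achievable K T r c L → MapReduce.storageOptimum K r ≤ L) := by
  have hi : 1 ≤ ⌊r⌋₊ := Nat.le_floor (by exact_mod_cast hr)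
  have hir : (⌊r⌋₊ : ℝ) ≤ r := Nat.floor_le (by linarith)
  have hri : r < ⌊r⌋₊ + 1 := Nat.lt_floor_add_one r
  have hiK : ⌊r⌋₊ + 1 ≤ K := by exact_mod_cast hir.trans_lt hrK
  have hach := MapReduce.achievable_cStar_storageOptimum hT hi hiK hir hri hrK
  have hconv : ∀ c L : ℝ, MapReduce.Achievable K T r c L → MapReduce.storageOptimum K r ≤ L :=
    fun c L h => h.storageOptimum_le hT hi hiK hir hri.le
  refine ⟨fun c hc _ => ?_, hach, hconv⟩
  refine IsLeast.csInf_eq ⟨fun ε hε => ?_, fun L hL => hconv c L hL⟩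
  -- Achievability is monotone in `c`, so the procedures for `cStar K r` serve for every larger `c`.
  obtain ⟨N₀, hN₀, h⟩ := hach ε hε
  refine ⟨N₀, hN₀, fun N hN => ?_⟩
  obtain ⟨P, hP, h1, h2, h3⟩ := h N hN
  exact ⟨P, hP, h1, by linarith, h3⟩
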